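/- For an integer $n\ge 1$ let, in polar coordinates $(r,\alpha)$ on $\mathbb R^2$, $$O_n=\{(\tfrac1n,\alpha): \tfrac{\pi}{2}\le\alpha\le 2\pi\},\qquad I_n=\{(r,\alpha_n): \tfrac1{n+1}\le r\le\tfrac1n\},$$ where $\alpha_n=\tfrac{\pi}{2}$ if $n$ is odd and $\alpha_n=0$ if $n$ is even. Let $$S=\bigcup_{n\ge1}(O_n\cup I_n)\cup\{(0,0)\}\subset\mathbb R^2$$ (the "snake"), with the Euclidean distance. An IFS (respectively, a weak IFS) on a metric space $(X,d)$ is a finite family $\mathcal F$ of maps $f\colon X\to X$ each of which has a Lipschitz constant less than $1$ (respectively, each of which satisfies $d(f(x),f(y))<d(x,y)$ for all $x\ne y$). A nonempty compact set $A\subset X$ with $A=\bigcup_{f\in\mathcal F}f(A)$ is called an attractor of $\mathcal F$. A Banach fractal is a compact metrizable space that is homeomorphic to the attractor of an IFS on a complete metric space. Then: 1. $S$ is an arc, that is, homeomorphic to $[0,1]$; 2. $S$ is an attractor of a weak IFS on $S$; 3. $S$ is a Banach fractal; 4. $S$ is not the attractor of any IFS: if $X$ is a metric space and $e\colon S\to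 X$ is an isometric embedding, then $e(S)$ is not the attractor of an IFS on $X$ (in particular this holds for $X=S$ and for $S\subset X=\mathbb R^2$). -/

import Mathlib

universe u

/-- A contraction of a metric space: a self-map with a Lipschitz constant smaller than `1`. -/
def IsContraction {X : Type u} [MetricSpace X] (f : X → X) : Prop :=
  ∃ K : NNReal, ContractingWith K f

/-- A weak contraction of a metric space: a self-map that strictly decreases the distance of any
two distinct points. -/
def IsWeakContraction {X : Type u} [MetricSpace X] (f : X → X) : Prop :=
  ∀ x y : X, x ≠ y → dist (f x) (f y) < dist x y

/-- `A` is a nonempty compact set with `A = ⋃ f ∈ F, f(A)`. -/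
def IsAttractorOf {X : Type u} [MetricSpace X] (F : Set (X → X)) (A : Set X) : Prop :=
  A.Nonempty ∧ IsCompact A ∧ A = ⋃ f ∈ F, f '' A

/-- `A` is the attractor of an IFS (a finite family of contractions) on `X`. -/
def IsIFSAttractor {X : Type u} [MetricSpace X] (A : Set X) : Prop :=
  ∃ F : Set (X → X), F.Finite ∧ (∀ f ∈ F, IsContraction f) ∧ IsAttractorOf F A

/-- `A` is an attractor of a weak IFS (a finite family of weak contractions) on `X`. -/
def IsWeakIFSAttractor {X : Type u} [MetricSpace X] (A : Set X) : Prop :=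
  ∃ F : Set (X → X), F.Finite ∧ (∀ f ∈ F, IsWeakContraction f) ∧ IsAttractorOf F A

/-- A Banach fractal: a compact metrizable space homeomorphic to the attractor of an IFS on a
complete metric space. -/
def IsBanachFractal (T : Type u) [TopologicalSpace T] : Prop :=
  CompactSpace T ∧ TopologicalSpace.MetrizableSpace T ∧
    ∃ (X : Type u) (_ : MetricSpace X) (_ : CompleteSpace X) (A : Set X),
      IsIFSAttractor A ∧ Nonempty (T ≃ₜ A)

/-- An arc: a space homeomorphic to the closed unit interval. -/
def IsArc (T : Type u) [TopologicalSpace T] : Prop :=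
  Nonempty (Set.Icc (0 : ℝ) 1 ≃ₜ T)

/-- The point of the Euclidean plane with polar coordinates `(r, α)`. -/
noncomputable def polarPoint (r α : ℝ) : EuclideanSpace ℝ (Fin 2) :=
  !₂[r * Real.cos α, r * Real.sin α]

/-- The circular arc `O_n` of radius `1 / n`, with angles from `π / 2` to `2 π`. -/
noncomputable def snakeArc (n : ℕ) : Set (EuclideanSpace ℝ (Fin 2)) :=
  {p | ∃ α ∈ Set.Icc (Real.pi / 2) (2 * Real.pi), p = polarPoint (1 / (n : ℝ)) α}

/-- The radial segment `I_n`, with radii from `1 / (n + 1)` to `1 / n`, at the angle `π / 2` if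
`n` is odd and `0` if `n` is even. -/
noncomputable def snakeSegment (n : ℕ) : Set (EuclideanSpace ℝ (Fin 2)) :=
  {p | ∃ r ∈ Set.Icc (1 / ((n : ℝ) + 1)) (1 / (n : ℝ)),
    p = polarPoint r (((n % 2 : ℕ) : ℝ) * (Real.pi / 2))}

/-- The snake: the union of all `O_n` and `I_n` with `n ≥ 1`, together with the origin. -/
noncomputable def snake : Set (EuclideanSpace ℝ (Fin 2)) :=
  (⋃ n : ℕ, ⋃ _ : 1 ≤ n, (snakeArc n ∪ snakeSegment n)) ∪ {0}

/-! Arc: a clock `u ≥ 0` traverses O_1, I_1, O_2, I_2, ... in unit times, with radius tending to 0;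
`t = 1 / (u + 1)`, completed by the origin at `t = 0`, gives a continuous bijection from the compact
interval [0,1] (`snakeHomeo`). As [0,1] is an IFS attractor, the snake is a Banach fractal.

Weak IFS: the radial map with 1/r ↦ 1/r + 2 strictly decreases distances (`dist_shrink_lt`) and
carries ring n onto ring n + 2. The two missing rings are rectifiable, and the norm maps the snake
onto [0,1] without increasing distances, so finitely many genuine contractions through [0,1] cover
them.

No IFS: the range of a contraction g of the snake is a subarc, so near the end 0 it is either a
neighbourhood of 0 or misses all other points. If finitely many ranges cover, one of them is a
neighbourhood of 0. This is impossible by length: points near 0 have preimages at least as far out,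
so all arcs of radius between 1/m and some fixed small radius lie in the image of the part of the
snake outside radius 1/m. Both lengths grow like `arcLength` times the harmonic sum H_m, while g
multiplies length by at most K < 1; m → ∞ gives the contradiction
(`range_notMem_nhds_of_contraction`). -/

/-! ### Distances in polar coordinates -/

/-- Law of cosines, arranged to separate the radial contribution from the angular one. -/
theorem dist_polarPoint_sq (r s α β : ℝ) :
    dist (polarPoint r α) (polarPoint s β) ^ 2 =
      (r - s) ^ 2 + 2 * r * s * (1 - Real.cos (α - β)) := by
  rw [EuclideanSpace.dist_eq, Real.sq_sqrt (by positivity), Fin.sum_univ_two, Real.cos_sub]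
  simp only [polarPoint, Real.dist_eq, sq_abs, PiLp.toLp_apply, Matrix.cons_val_zero,
    Matrix.cons_val_one]
  linear_combination r ^ 2 * Real.sin_sq_add_cos_sq α + s ^ 2 * Real.sin_sq_add_cos_sq β

theorem norm_polarPoint {r : ℝ} (hr : 0 ≤ r) (α : ℝ) : ‖polarPoint r α‖ = r := by
  rw [EuclideanSpace.norm_eq, Fin.sum_univ_two]
  simp only [polarPoint, Real.norm_eq_abs, sq_abs, PiLp.toLp_apply, Matrix.cons_val_zero,
    Matrix.cons_val_one]
  rw [show (r * Real.cos α) ^ 2 + (r * Real.sin α) ^ 2 = r ^ 2 by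
    linear_combination r ^ 2 * Real.sin_sq_add_cos_sq α, Real.sqrt_sq hr]

theorem smul_polarPoint (c r α : ℝ) : c • polarPoint r α = polarPoint (c * r) α := by
  ext i
  fin_cases i <;> simp [polarPoint, mul_assoc]

theorem continuous_polarPoint : Continuous fun x : ℝ × ℝ => polarPoint x.1 x.2 := by
  unfold polarPoint
  refine (PiLp.continuous_toLp 2 _).comp (continuous_pi fun i => ?_)
  fin_cases i
  · exact continuous_fst.mul (Real.continuous_cos.comp continuous_snd)
  · exact continuous_fst.mul (Real.continuous_sin.comp continuous_snd)

theorem dist_polarPoint_angle_le {r : ℝ} (hr : 0 ≤ r) (α β : ℝ) :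
    dist (polarPoint r α) (polarPoint r β) ≤ r * dist α β := by
  refine (sq_le_sq₀ dist_nonneg (by positivity)).mp ?_
  rw [dist_polarPoint_sq, mul_pow, Real.dist_eq, sq_abs]
  nlinarith [Real.one_sub_sq_div_two_le_cos (x := α - β), sq_nonneg r]

theorem dist_polarPoint_radius (r s α : ℝ) :
    dist (polarPoint r α) (polarPoint s α) = dist r s := by
  rw [← sq_eq_sq₀ dist_nonneg dist_nonneg, dist_polarPoint_sq, Real.dist_eq, sq_abs]
  simp

/-- Polar coordinates with a positive radius and an angle in `[π / 2, 2 π]` are unique. -/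
theorem polarPoint_angle_injOn {r : ℝ} (hr : 0 < r) :
    Set.InjOn (polarPoint r) (Set.Icc (Real.pi / 2) (2 * Real.pi)) := by
  intro α hα β hβ h
  have h1 := dist_polarPoint_sq r r α β
  rw [h, dist_self] at h1
  have h2 : Real.cos (α - β) = 1 := by
    have : 2 * r * r * (1 - Real.cos (α - β)) = 0 := by linarith
    have h3 : 2 * r * r ≠ 0 := by positivity
    linarith [(mul_eq_zero.mp this).resolve_left h3]
  have hpi := Real.pi_pos
  rw [Real.cos_eq_one_iff_of_lt_of_lt (by linarith [hα.1, hβ.2]) (by linarith [hα.2, hβ.1])] at h2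
  linarith

theorem mem_snake {p : EuclideanSpace ℝ (Fin 2)} :
    p ∈ snake ↔ p = 0 ∨ ∃ n : ℕ, 1 ≤ n ∧ (p ∈ snakeArc n ∨ p ∈ snakeSegment n) := by
  simp [snake]

theorem norm_of_mem_snakeArc {n : ℕ} {p : EuclideanSpace ℝ (Fin 2)} (hp : p ∈ snakeArc n) :
    ‖p‖ = 1 / n := by
  obtain ⟨α, -, rfl⟩ := hp
  exact norm_polarPoint (by positivity) α

theorem norm_of_mem_snakeSegment {n : ℕ} {p : EuclideanSpace ℝ (Fin 2)}
    (hp : p ∈ snakeSegment n) : ‖p‖ ∈ Set.Icc (1 / ((n : ℝ) + 1)) (1 / n) := by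
  obtain ⟨r, hr, rfl⟩ := hp
  rwa [norm_polarPoint (le_trans (by positivity) hr.1)]

/-! ### The snake is an arc -/

/-- The continuous staircase that increases with slope `1` on each `[2 k, 2 k + 1]` and is
constant on each `[2 k + 1, 2 k + 2]`. -/
noncomputable def stair (u : ℝ) : ℝ :=
  ⌊u / 2⌋ + min 1 (2 * Int.fract (u / 2))

theorem continuous_stair : Continuous stair := by
  -- Subtracting the linear part u/2 leaves a 1-periodic function of u/2, continuous because `min 1
  -- (2 * x) - x` vanishes at both 0 and 1.
  have h : Continuous fun u : ℝ => (fun x : ℝ => min 1 (2 * x) - x) (Int.fract u) :=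
    ContinuousOn.comp_fract'' (f := fun x : ℝ => min 1 (2 * x) - x) (by fun_prop) (by norm_num)
  have h2 : stair = fun u => u / 2 + (min 1 (2 * Int.fract (u / 2)) - Int.fract (u / 2)) := by
    funext u
    rw [stair]
    linarith [Int.floor_add_fract (u / 2)]
  rw [h2]
  exact (continuous_id.div_const 2).add (h.comp (continuous_id.div_const 2))

theorem stair_eq {k : ℤ} {u : ℝ} (h1 : 2 * k ≤ u) (h2 : u ≤ 2 * k + 2) :
    stair u = k + min 1 (u - 2 * k) := by
  rcases h2.lt_or_eq with h2 | rfl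
  · have h3 : ⌊u / 2⌋ = k := Int.floor_eq_iff.mpr ⟨by linarith, by linarith⟩
    rw [stair, Int.fract, h3]
    congr 2
    ring
  · have h3 : (2 * (k : ℝ) + 2) / 2 = ((k + 1 : ℤ) : ℝ) := by push_cast; ring
    rw [stair, h3, Int.floor_intCast, Int.fract_intCast]
    norm_num

theorem stair_eq_sub {k : ℤ} {u : ℝ} (h1 : 2 * k ≤ u) (h2 : u ≤ 2 * k + 1) :
    stair u = u - k := by
  rw [stair_eq h1 (by linarith), min_eq_right (by linarith)]
  ring

theorem stair_eq_const {k : ℤ} {u : ℝ} (h1 : 2 * k + 1 ≤ u) (h2 : u ≤ 2 * k + 2) :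
    stair u = k + 1 := by
  rw [stair_eq (by linarith) h2, min_eq_left (by linarith)]

/-- Linear growth of the reciprocal radius along the path; this yields continuity of `snakeParam` at
the origin. -/
theorem half_le_stair (u : ℝ) : u / 2 ≤ stair u := by
  have h := Int.floor_add_fract (u / 2)
  have h0 := Int.fract_nonneg (u / 2)
  have h1 := Int.fract_lt_one (u / 2)
  rw [stair]
  have : Int.fract (u / 2) ≤ min 1 (2 * Int.fract (u / 2)) := le_min h1.le (by linarith)
  linarith

/-- The angle, swinging between `π / 2` and `2 π`, along the snake. -/
noncomputable def swing (a : ℝ) : ℝ :=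
  5 * Real.pi / 4 + 3 * Real.pi / 4 * Real.cos (a * Real.pi)

theorem swing_mem (a : ℝ) : swing a ∈ Set.Icc (Real.pi / 2) (2 * Real.pi) := by
  have h1 := Real.neg_one_le_cos (a * Real.pi)
  have h2 := Real.cos_le_one (a * Real.pi)
  have := Real.pi_pos
  constructor <;> rw [swing] <;> nlinarith

/-- Up to sign, each half-period of the cosine reduces to [0, π], where `arccos` inverts it. -/
theorem cos_mul_pi_shift (k : ℕ) (a : ℝ) :
    Real.cos (a * Real.pi) = (-1) ^ k * Real.cos ((a - k) * Real.pi) := by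
  rw [sub_mul, Real.cos_sub_nat_mul_pi, ← mul_assoc, ← mul_pow]
  simp

theorem swing_injOn (k : ℕ) : Set.InjOn swing (Set.Icc (k : ℝ) (k + 1)) := by
  intro a ha b hb h
  have hpi := Real.pi_pos
  rw [swing, swing, cos_mul_pi_shift k a, cos_mul_pi_shift k b] at h
  have h1 : (-1 : ℝ) ^ k * Real.cos ((a - k) * Real.pi) =
      (-1) ^ k * Real.cos ((b - k) * Real.pi) := by
    have : 3 * Real.pi / 4 ≠ 0 := by positivity
    exact mul_left_cancel₀ this (by linarith)
  have h2 := mul_left_cancel₀ (pow_ne_zero k (by norm_num)) h1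
  have h3 := Real.injOn_cos (x₁ := (a - k) * Real.pi) (x₂ := (b - k) * Real.pi)
    ⟨mul_nonneg (by linarith [ha.1]) hpi.le, by nlinarith [ha.2]⟩
    ⟨mul_nonneg (by linarith [hb.1]) hpi.le, by nlinarith [hb.2]⟩ h2
  linarith [mul_right_cancel₀ hpi.ne' h3]

theorem swing_surjOn (k : ℕ) :
    Set.SurjOn swing (Set.Icc (k : ℝ) (k + 1)) (Set.Icc (Real.pi / 2) (2 * Real.pi)) := by
  intro α hα
  have hpi := Real.pi_pos
  set c := (α - 5 * Real.pi / 4) / (3 * Real.pi / 4) with hc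
  have hc1 : |c| ≤ 1 := by
    rw [abs_le, hc, le_div_iff₀ (by positivity), div_le_iff₀ (by positivity)]
    constructor <;> linarith [hα.1, hα.2]
  have hs : |(-1 : ℝ) ^ k * c| ≤ 1 := by simpa [abs_mul] using hc1
  obtain ⟨hs1, hs2⟩ := abs_le.mp hs
  refine ⟨k + Real.arccos ((-1) ^ k * c) / Real.pi, ⟨?_, ?_⟩, ?_⟩
  · have := Real.arccos_nonneg ((-1) ^ k * c)
    have : 0 ≤ Real.arccos ((-1) ^ k * c) / Real.pi := by positivity
    linarith
  · have := Real.arccos_le_pi ((-1) ^ k * c)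
    have : Real.arccos ((-1) ^ k * c) / Real.pi ≤ 1 := (div_le_one hpi).mpr this
    linarith
  · have h1 : (-1 : ℝ) ^ k * ((-1) ^ k * c) = c := by
      rw [← mul_assoc, ← mul_pow]
      simp
    rw [swing, cos_mul_pi_shift k, add_sub_cancel_left, div_mul_cancel₀ _ hpi.ne',
      Real.cos_arccos hs1 hs2, h1, hc, mul_div_cancel₀]
    · ring
    · positivity

/-- The angle at integer times is the angle of the corresponding radial segment. -/
theorem polarPoint_swing_nat (r : ℝ) (n : ℕ) :
    polarPoint r (swing n) = polarPoint r (((n % 2 : ℕ) : ℝ) * (Real.pi / 2)) := by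
  rw [swing, Real.cos_nat_mul_pi]
  rcases Nat.mod_two_eq_zero_or_one n with h | h
  · rw [(Nat.even_iff.mpr h).neg_one_pow, h]
    rw [show 5 * Real.pi / 4 + 3 * Real.pi / 4 * 1 = 2 * Real.pi by ring]
    simp [polarPoint]
  · rw [(Nat.odd_iff.mpr h).neg_one_pow, h]
    congr 1
    push_cast
    ring

/-- A parametrization of the snake without the origin by `[0, ∞)`. -/
noncomputable def snakePath (u : ℝ) : EuclideanSpace ℝ (Fin 2) :=
  polarPoint (1 / (1 + stair (u - 1))) (swing (stair u))

/-- The unit delay between the two staircases in `snakePath` makes angle and radius move in turn: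
here the radius rests, and on the following unit interval the angle does. -/
theorem snakePath_of_arc {k : ℕ} {u : ℝ} (h1 : 2 * k ≤ u) (h2 : u ≤ 2 * k + 1) :
    snakePath u = polarPoint (1 / ((k + 1 : ℕ) : ℝ)) (swing (u - k)) := by
  have e1 : stair u = u - k := by
    simpa using stair_eq_sub (k := k) (u := u) (by simpa using h1) (by simpa using h2)
  have e2 : stair (u - 1) = k := by
    have := stair_eq_const (k := (k : ℤ) - 1) (u := u - 1) (by push_cast; linarith)
      (by push_cast; linarith)
    simpa using this
  rw [snakePath, e1, e2]
  push_cast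
  rw [add_comm]

theorem snakePath_of_segment {k : ℕ} {u : ℝ} (h1 : 2 * k + 1 ≤ u) (h2 : u ≤ 2 * k + 2) :
    snakePath u =
      polarPoint (1 / (u - k)) ((((k + 1) % 2 : ℕ) : ℝ) * (Real.pi / 2)) := by
  have e1 : stair u = ((k + 1 : ℕ) : ℝ) := by
    simpa using stair_eq_const (k := k) (u := u) (by simpa using h1) (by simpa using h2)
  have e2 : stair (u - 1) = u - 1 - k := by
    simpa using stair_eq_sub (k := k) (u := u - 1) (by push_cast; linarith)
      (by push_cast; linarith)
  rw [snakePath, e1, e2, polarPoint_swing_nat]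
  congr 2
  ring

theorem arc_or_segment {u : ℝ} (hu : 0 ≤ u) :
    ∃ k : ℕ, (2 * k ≤ u ∧ u ≤ 2 * k + 1) ∨ (2 * k + 1 < u ∧ u < 2 * k + 2) := by
  refine ⟨⌊u / 2⌋₊, ?_⟩
  have h1 := Nat.floor_le (a := u / 2) (by positivity)
  have h2 := Nat.lt_floor_add_one (u / 2)
  rcases le_or_gt u (2 * ⌊u / 2⌋₊ + 1) with h | h
  · exact Or.inl ⟨by linarith, h⟩
  · exact Or.inr ⟨h, by linarith⟩

theorem snakePath_mem {u : ℝ} (hu : 0 ≤ u) : snakePath u ∈ snake := by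
  obtain ⟨k, ⟨h1, h2⟩ | ⟨h1, h2⟩⟩ := arc_or_segment hu
  · exact mem_snake.mpr (Or.inr ⟨k + 1, by omega, Or.inl ⟨_, swing_mem _, snakePath_of_arc h1 h2⟩⟩)
  · refine mem_snake.mpr (Or.inr ⟨k + 1, by omega, Or.inr ⟨_, ⟨?_, ?_⟩,
      snakePath_of_segment h1.le h2.le⟩⟩)
    · push_cast
      exact one_div_le_one_div_of_le (by linarith [(Nat.cast_nonneg k : (0 : ℝ) ≤ k)])
        (by linarith)
    · push_cast
      exact one_div_le_one_div_of_le (by positivity) (by linarith)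

theorem half_le_radius (u : ℝ) : (u + 1) / 2 ≤ 1 + stair (u - 1) := by
  linarith [half_le_stair (u - 1)]

theorem norm_snakePath {u : ℝ} (hu : 0 ≤ u) : ‖snakePath u‖ = 1 / (1 + stair (u - 1)) :=
  norm_polarPoint (one_div_nonneg.mpr (by linarith [half_le_radius u])) _

theorem norm_snakePath_arc {k : ℕ} {u : ℝ} (h1 : 2 * k ≤ u) (h2 : u ≤ 2 * k + 1) :
    1 / ‖snakePath u‖ = k + 1 := by
  rw [snakePath_of_arc h1 h2, norm_polarPoint (by positivity), one_div_one_div]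
  push_cast
  rfl

theorem norm_snakePath_segment {k : ℕ} {u : ℝ} (h1 : 2 * k + 1 ≤ u) (h2 : u ≤ 2 * k + 2) :
    1 / ‖snakePath u‖ = u - k := by
  rw [snakePath_of_segment h1 h2, norm_polarPoint, one_div_one_div]
  exact one_div_nonneg.mpr (by linarith [(Nat.cast_nonneg k : (0 : ℝ) ≤ k)])

/-- The reciprocal norm is the integer k + 1 on an arc and lies strictly between k + 1 and k + 2
inside a segment, so it identifies the piece. It then determines u on a segment; on an arc the angle
does. -/
theorem snakePath_injOn : Set.InjOn snakePath (Set.Ici 0) := by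
  intro u hu v hv h
  obtain ⟨k, ⟨h1, h2⟩ | ⟨h1, h2⟩⟩ := arc_or_segment hu <;>
    obtain ⟨l, ⟨h3, h4⟩ | ⟨h3, h4⟩⟩ := arc_or_segment hv
  · have e := norm_snakePath_arc h1 h2
    rw [h, norm_snakePath_arc h3 h4] at e
    have e' : l = k := by exact_mod_cast add_right_cancel e
    subst e'
    rw [snakePath_of_arc h1 h2, snakePath_of_arc h3 h4] at h
    have h5 := polarPoint_angle_injOn (by positivity) (swing_mem _) (swing_mem _) h
    have h6 := swing_injOn l (x₁ := u - l) (x₂ := v - l) ⟨by linarith, by linarith⟩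
      ⟨by linarith, by linarith⟩ h5
    linarith
  · have e := norm_snakePath_arc h1 h2
    rw [h, norm_snakePath_segment h3.le h4.le] at e
    have a1 : (l : ℝ) < k := by linarith
    have a2 : (k : ℝ) < l + 1 := by linarith
    norm_cast at a1 a2
    omega
  · have e := norm_snakePath_segment h1.le h2.le
    rw [h, norm_snakePath_arc h3 h4] at e
    have a1 : (k : ℝ) < l := by linarith
    have a2 : (l : ℝ) < k + 1 := by linarith
    norm_cast at a1 a2
    omega
  · have e := norm_snakePath_segment h1.le h2.le
    rw [h, norm_snakePath_segment h3.le h4.le] at e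
    have a1 : (k : ℝ) < l + 1 := by linarith
    have a2 : (l : ℝ) < k + 1 := by linarith
    norm_cast at a1 a2
    have e' : k = l := by omega
    subst e'
    linarith

theorem exists_snakePath_eq {p : EuclideanSpace ℝ (Fin 2)} (hp : p ∈ snake) (h0 : p ≠ 0) :
    ∃ u, 0 ≤ u ∧ snakePath u = p := by
  obtain ⟨n, hn, h⟩ := (mem_snake.mp hp).resolve_left h0
  obtain ⟨k, rfl⟩ := Nat.exists_eq_add_of_le' hn
  have hk : (0 : ℝ) ≤ k := Nat.cast_nonneg k
  rcases h with ⟨α, hα, rfl⟩ | ⟨r, ⟨hr1, hr2⟩, rfl⟩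
  · obtain ⟨a, ha, rfl⟩ := swing_surjOn k hα
    refine ⟨a + k, by linarith [ha.1], ?_⟩
    rw [snakePath_of_arc (k := k) (by linarith [ha.1]) (by linarith [ha.2])]
    simp
  · push_cast at hr1 hr2
    have hr : 0 < r := lt_of_lt_of_le (by positivity) hr1
    have b1 : 1 / r ≤ k + 2 := by
      rw [one_div_le hr (by positivity)]
      convert hr1 using 2
      ring
    have b2 : k + 1 ≤ 1 / r := by rwa [le_one_div (by positivity) hr]
    refine ⟨1 / r + k, by positivity, ?_⟩
    rw [snakePath_of_segment (k := k) (by linarith) (by linarith)]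
    simp

theorem continuousOn_snakePath : ContinuousOn snakePath (Set.Ici 0) := by
  have h : ContinuousOn (fun u => (1 / (1 + stair (u - 1)), swing (stair u))) (Set.Ici 0) := by
    refine ContinuousOn.prodMk (ContinuousOn.div continuousOn_const ?_ ?_) ?_
    · exact (continuous_const.add
        (continuous_stair.comp (continuous_id.sub continuous_const))).continuousOn
    · intro u hu
      have := half_le_radius u
      have hu' : (0 : ℝ) ≤ u := hu
      linarith
    · have := continuous_stair
      unfold swing
      fun_prop
  exact continuous_polarPoint.comp_continuousOn h

/-- A parametrization of the snake by `[0, 1]`, starting at the origin. -/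
noncomputable def snakeParam (t : ℝ) : EuclideanSpace ℝ (Fin 2) :=
  if t = 0 then 0 else snakePath (1 / t - 1)

theorem inv_sub_one_nonneg {t : ℝ} (h0 : 0 < t) (h1 : t ≤ 1) : 0 ≤ 1 / t - 1 := by
  linarith [(one_le_div h0).mpr h1]

theorem norm_snakeParam_le {t : ℝ} (ht : t ∈ Set.Icc (0 : ℝ) 1) : ‖snakeParam t‖ ≤ 2 * t := by
  rcases ht.1.eq_or_lt with rfl | h0
  · simp [snakeParam]
  · rw [snakeParam, if_neg h0.ne', norm_snakePath (inv_sub_one_nonneg h0 ht.2)]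
    have h := half_le_radius (1 / t - 1)
    rw [sub_add_cancel] at h
    have h2 := one_div_le_one_div_of_le (by positivity) h
    calc _ ≤ _ := h2
      _ = 2 * t := by field_simp

theorem snakeParam_mem {t : ℝ} (ht : t ∈ Set.Icc (0 : ℝ) 1) : snakeParam t ∈ snake := by
  rcases ht.1.eq_or_lt with rfl | h0
  · simp [snakeParam, mem_snake]
  · rw [snakeParam, if_neg h0.ne']
    exact snakePath_mem (inv_sub_one_nonneg h0 ht.2)

theorem snakePath_ne_zero {u : ℝ} (hu : 0 ≤ u) : snakePath u ≠ 0 := by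
  rw [← norm_ne_zero_iff, norm_snakePath hu]
  exact one_div_ne_zero (by linarith [half_le_radius u])

theorem snakeParam_injOn : Set.InjOn snakeParam (Set.Icc 0 1) := by
  intro s hs t ht h
  rcases hs.1.eq_or_lt with rfl | h0 <;> rcases ht.1.eq_or_lt with rfl | h1
  · rfl
  · rw [snakeParam, snakeParam, if_pos rfl, if_neg h1.ne'] at h
    exact absurd h.symm (snakePath_ne_zero (inv_sub_one_nonneg h1 ht.2))
  · rw [snakeParam, snakeParam, if_pos rfl, if_neg h0.ne'] at h
    exact absurd h (snakePath_ne_zero (inv_sub_one_nonneg h0 hs.2))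
  · rw [snakeParam, snakeParam, if_neg h1.ne', if_neg h0.ne'] at h
    have := snakePath_injOn (inv_sub_one_nonneg h0 hs.2) (inv_sub_one_nonneg h1 ht.2) h
    rw [sub_left_inj] at this
    simpa using this

theorem exists_snakeParam_eq {p : EuclideanSpace ℝ (Fin 2)} (hp : p ∈ snake) :
    ∃ t ∈ Set.Icc (0 : ℝ) 1, snakeParam t = p := by
  by_cases h0 : p = 0
  · exact ⟨0, by simp, by simp [snakeParam, h0]⟩
  · obtain ⟨u, hu, rfl⟩ := exists_snakePath_eq hp h0
    refine ⟨1 / (u + 1), ⟨by positivity, ?_⟩, ?_⟩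
    · rw [div_le_one (by positivity)]
      linarith
    · rw [snakeParam, if_neg (by positivity), one_div_one_div, add_sub_cancel_right]

theorem continuousOn_snakeParam : ContinuousOn snakeParam (Set.Icc 0 1) := by
  intro t ht
  rcases ht.1.eq_or_lt with rfl | h0
  · have h : Filter.Tendsto (fun t : ℝ => 2 * t) (nhdsWithin 0 (Set.Icc 0 1)) (nhds 0) := by
      have : ContinuousWithinAt (fun t : ℝ => 2 * t) (Set.Icc 0 1) 0 := by fun_prop
      simpa [ContinuousWithinAt] using this
    have h2 : snakeParam 0 = 0 := by simp [snakeParam]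
    rw [ContinuousWithinAt, h2]
    refine squeeze_zero_norm' ?_ h
    filter_upwards [self_mem_nhdsWithin] with t ht using norm_snakeParam_le ht
  · have h : ContinuousWithinAt (fun t => snakePath (1 / t - 1)) (Set.Ioc 0 1) t := by
      refine ContinuousWithinAt.comp (g := snakePath) (f := fun t => 1 / t - 1) (t := Set.Ici 0)
        (continuousOn_snakePath _ (inv_sub_one_nonneg h0 ht.2)) ?_
        fun s hs => inv_sub_one_nonneg hs.1 hs.2
      have h1 : ContinuousAt (fun t : ℝ => 1 / t - 1) t :=
        (continuousAt_const.div continuousAt_id h0.ne').sub continuousAt_const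
      exact h1.continuousWithinAt
    have h2 : ContinuousWithinAt snakeParam (Set.Ioc 0 1) t :=
      h.congr (fun s hs => by rw [snakeParam, if_neg hs.1.ne']) (by rw [snakeParam, if_neg h0.ne'])
    refine h2.mono_of_mem_nhdsWithin ?_
    filter_upwards [self_mem_nhdsWithin, mem_nhdsWithin_of_mem_nhds (Ioi_mem_nhds h0)] with s hs hs'
      using ⟨hs', hs.2⟩

theorem bijective_snakeParam : Function.Bijective
    fun t : Set.Icc (0 : ℝ) 1 => (⟨snakeParam t, snakeParam_mem t.2⟩ : snake) := by
  constructor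
  · intro s t h
    exact Subtype.ext (snakeParam_injOn s.2 t.2 (congrArg Subtype.val h))
  · rintro ⟨p, hp⟩
    obtain ⟨t, ht, rfl⟩ := exists_snakeParam_eq hp
    exact ⟨⟨t, ht⟩, rfl⟩

/-- The snake is an arc, one of whose ends is the origin. -/
noncomputable def snakeHomeo : Set.Icc (0 : ℝ) 1 ≃ₜ snake :=
  Continuous.homeoOfEquivCompactToT2 (f := Equiv.ofBijective _ bijective_snakeParam)
    ((continuousOn_iff_continuous_domRestrict.mp continuousOn_snakeParam).subtype_mk _)

theorem snakeHomeo_coe (t : Set.Icc (0 : ℝ) 1) :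
    (snakeHomeo t : EuclideanSpace ℝ (Fin 2)) = snakeParam t := rfl

theorem zero_mem_snake : (0 : EuclideanSpace ℝ (Fin 2)) ∈ snake := mem_snake.mpr (Or.inl rfl)

theorem snakeHomeo_zero : snakeHomeo 0 = ⟨0, zero_mem_snake⟩ :=
  Subtype.ext (by rw [snakeHomeo_coe]; simp [snakeParam])

theorem isArc_snake : IsArc snake := ⟨snakeHomeo⟩

instance compactSpace_snake : CompactSpace snake := snakeHomeo.compactSpace

/-! ### The snake is a Banach fractal -/

/-- The unit interval is the attractor of an IFS on the line. -/
theorem isIFSAttractor_Icc : IsIFSAttractor (Set.Icc (0 : ℝ) 1) := by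
  have key : ∀ c : ℝ, IsContraction fun x : ℝ => (x + c) / 2 := by
    intro c
    refine ⟨1 / 2, by rw [← NNReal.coe_lt_coe]; norm_num, LipschitzWith.of_dist_le_mul fun x y => ?_⟩
    rw [Real.dist_eq, Real.dist_eq, show (x + c) / 2 - (y + c) / 2 = 1 / 2 * (x - y) by ring,
      abs_mul]
    norm_num
  refine ⟨{fun x => (x + 0) / 2, fun x => (x + 1) / 2}, by simp, ?_, ?_⟩
  · rintro f (rfl | rfl)
    exacts [key 0, key 1]
  · refine ⟨⟨0, by simp⟩, isCompact_Icc, ?_⟩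
    rw [Set.biUnion_pair]
    ext x
    constructor
    · intro hx
      rcases le_total x (1 / 2) with h | h
      · exact Or.inl ⟨2 * x, ⟨by linarith [hx.1], by linarith⟩, by simp⟩
      · exact Or.inr ⟨2 * x - 1, ⟨by linarith, by linarith [hx.2]⟩, by simp⟩
    · rintro (⟨y, hy, rfl⟩ | ⟨y, hy, rfl⟩) <;> constructor <;> simp only <;>
        linarith [hy.1, hy.2]

theorem isBanachFractal_snake : IsBanachFractal snake :=
  ⟨inferInstance, inferInstance, ℝ, inferInstance, inferInstance, _, isIFSAttractor_Icc,
    ⟨snakeHomeo.symm⟩⟩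

/-! ### The snake is a weak IFS attractor -/

theorem polarPoint_mem_snake_of_arc {n : ℕ} (hn : 1 ≤ n) {α : ℝ}
    (hα : α ∈ Set.Icc (Real.pi / 2) (2 * Real.pi)) : polarPoint (1 / n) α ∈ snake :=
  mem_snake.mpr (Or.inr ⟨n, hn, Or.inl ⟨α, hα, rfl⟩⟩)

theorem polarPoint_mem_snake_of_segment {n : ℕ} (hn : 1 ≤ n) {r : ℝ}
    (hr : r ∈ Set.Icc (1 / ((n : ℝ) + 1)) (1 / n)) :
    polarPoint r (((n % 2 : ℕ) : ℝ) * (Real.pi / 2)) ∈ snake :=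
  mem_snake.mpr (Or.inr ⟨n, hn, Or.inr ⟨r, hr, rfl⟩⟩)

theorem polarPoint_zero (α : ℝ) : polarPoint 0 α = 0 := by
  simpa using norm_polarPoint le_rfl α

theorem exists_polarPoint_of_mem_snake {p : EuclideanSpace ℝ (Fin 2)} (hp : p ∈ snake) :
    ∃ r α, 0 ≤ r ∧ p = polarPoint r α := by
  rcases mem_snake.mp hp with rfl | ⟨n, -, ⟨α, -, rfl⟩ | ⟨r, hr, rfl⟩⟩
  · exact ⟨0, 0, le_rfl, (polarPoint_zero 0).symm⟩
  · exact ⟨_, _, by positivity, rfl⟩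
  · exact ⟨_, _, le_trans (by positivity) hr.1, rfl⟩

/-- The radial map of the plane with `1 / r ↦ 1 / r + 2`. -/
noncomputable def shrink (p : EuclideanSpace ℝ (Fin 2)) : EuclideanSpace ℝ (Fin 2) :=
  (1 / (1 + 2 * ‖p‖)) • p

theorem shrink_polarPoint {r : ℝ} (hr : 0 ≤ r) (α : ℝ) :
    shrink (polarPoint r α) = polarPoint (r / (1 + 2 * r)) α := by
  rw [shrink, norm_polarPoint hr, smul_polarPoint, one_div_mul_eq_div]

/-- With D = (1 + 2r)(1 + 2s), the radial term of the squared distance is divided by D² and the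
angular term by D. Distinct points are not both the origin, so D > 1; but D → 1 at the origin, so
the contraction is only weak. -/
theorem dist_shrink_lt {r s α β : ℝ} (hr : 0 ≤ r) (hs : 0 ≤ s)
    (h : polarPoint r α ≠ polarPoint s β) :
    dist (shrink (polarPoint r α)) (shrink (polarPoint s β)) <
      dist (polarPoint r α) (polarPoint s β) := by
  refine (sq_lt_sq₀ dist_nonneg dist_nonneg).mp ?_
  have hpos : 0 < dist (polarPoint r α) (polarPoint s β) ^ 2 := pow_pos (dist_pos.mpr h) 2
  rw [shrink_polarPoint hr, shrink_polarPoint hs]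
  rw [dist_polarPoint_sq] at hpos ⊢
  rw [dist_polarPoint_sq]
  have hc : 0 ≤ 1 - Real.cos (α - β) := by linarith [Real.cos_le_one (α - β)]
  have hrs : 0 < r + s := by
    by_contra hn
    have h1 : r = 0 := by linarith
    have h2 : s = 0 := by linarith
    exact h (by rw [h1, h2, polarPoint_zero, polarPoint_zero])
  have hD : 1 < (1 + 2 * r) * (1 + 2 * s) := by nlinarith [mul_nonneg hr hs]
  set D := (1 + 2 * r) * (1 + 2 * s) with hDdef
  have e1 : (r / (1 + 2 * r) - s / (1 + 2 * s)) ^ 2 = (r - s) ^ 2 / D / D := by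
    rw [hDdef]
    field_simp
    ring
  have e2 : 2 * (r / (1 + 2 * r)) * (s / (1 + 2 * s)) * (1 - Real.cos (α - β)) =
      2 * r * s * (1 - Real.cos (α - β)) / D := by
    rw [hDdef]
    field_simp
  rw [e1, e2, ← add_div]
  have h3 : (r - s) ^ 2 / D ≤ (r - s) ^ 2 := div_le_self (sq_nonneg _) hD.le
  calc _ ≤ ((r - s) ^ 2 + 2 * r * s * (1 - Real.cos (α - β))) / D := by gcongr
    _ < _ := div_lt_self hpos hD

theorem radius_shift {r : ℝ} (hr : 0 < r) : r / (1 + 2 * r) = 1 / (1 / r + 2) := by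
  field_simp

/-- The shift of 1/r is by 2 rather than 1 because the angle of a segment depends on the parity of
n. -/
theorem shrink_mem_snake {p : EuclideanSpace ℝ (Fin 2)} (hp : p ∈ snake) : shrink p ∈ snake := by
  rcases mem_snake.mp hp with rfl | ⟨n, hn, ⟨α, hα, rfl⟩ | ⟨r, ⟨hr1, hr2⟩, rfl⟩⟩
  · simpa [shrink] using zero_mem_snake
  · have hn' : (0 : ℝ) < n := by exact_mod_cast hn
    rw [shrink_polarPoint (by positivity), radius_shift (by positivity), one_div_one_div]
    exact_mod_cast polarPoint_mem_snake_of_arc (n := n + 2) (by omega) hα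
  · have hn' : (0 : ℝ) < n := by exact_mod_cast hn
    have hr : 0 < r := lt_of_lt_of_le (by positivity) hr1
    rw [shrink_polarPoint hr.le, radius_shift hr, ← Nat.add_mod_right n 2]
    have b1 : 1 / r ≤ n + 1 := by rwa [one_div_le hr (by positivity)]
    have b2 : n ≤ 1 / r := by rwa [le_one_div (by positivity) hr]
    refine polarPoint_mem_snake_of_segment (by omega) ⟨?_, ?_⟩ <;> push_cast <;>
      exact one_div_le_one_div_of_le (by positivity) (by linarith)

theorem exists_shrink_eq {n : ℕ} (hn : 3 ≤ n) {p : EuclideanSpace ℝ (Fin 2)}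
    (hp : p ∈ snakeArc n ∨ p ∈ snakeSegment n) : ∃ q ∈ snake, shrink q = p := by
  obtain ⟨k, rfl⟩ := Nat.exists_eq_add_of_le' hn
  have hk : (0 : ℝ) ≤ k := Nat.cast_nonneg k
  rcases hp with ⟨α, hα, rfl⟩ | ⟨r, ⟨hr1, hr2⟩, rfl⟩
  · refine ⟨_, polarPoint_mem_snake_of_arc (n := k + 1) (by omega) hα, ?_⟩
    rw [shrink_polarPoint (by positivity), radius_shift (by positivity), one_div_one_div]
    push_cast
    congr 2
    ring
  · push_cast at hr1 hr2
    have hr : 0 < r := lt_of_lt_of_le (by positivity) hr1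
    have b1 : 1 / r ≤ k + 3 + 1 := by rwa [one_div_le hr (by positivity)]
    have b2 : k + 3 ≤ 1 / r := by rwa [le_one_div (by positivity) hr]
    have hpos : 0 < 1 / r - 2 := by linarith
    refine ⟨_, polarPoint_mem_snake_of_segment (n := k + 1) (r := 1 / (1 / r - 2)) (by omega)
      ⟨?_, ?_⟩, ?_⟩
    · push_cast
      exact one_div_le_one_div_of_le hpos (by linarith)
    · push_cast
      exact one_div_le_one_div_of_le (by positivity) (by linarith)
    · rw [shrink_polarPoint (by positivity), radius_shift (by positivity), one_div_one_div,
        sub_add_cancel, one_div_one_div, show k + 3 = k + 1 + 2 from rfl, Nat.add_mod_right]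

theorem exists_snake_norm_eq {x : ℝ} (hx : x ∈ Set.Icc (0 : ℝ) 1) :
    ∃ p : snake, ‖(p : EuclideanSpace ℝ (Fin 2))‖ = x := by
  have : PreconnectedSpace snake := by
    have : PreconnectedSpace (Set.Icc (0 : ℝ) 1) :=
      Subtype.preconnectedSpace isPreconnected_Icc
    exact snakeHomeo.surjective.denseRange.preconnectedSpace snakeHomeo.continuous
  have hc : Continuous fun p : snake => ‖(p : EuclideanSpace ℝ (Fin 2))‖ := by fun_prop
  have hpi := Real.pi_pos
  have h1 := polarPoint_mem_snake_of_arc (n := 1) le_rfl (α := 2 * Real.pi)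
    ⟨by linarith, le_rfl⟩
  refine mem_range_of_exists_le_of_exists_ge hc ⟨⟨0, zero_mem_snake⟩, ?_⟩ ⟨⟨_, h1⟩, ?_⟩
  · simpa using hx.1
  · rw [norm_polarPoint (by positivity)]
    simpa using hx.2

/-- Rectifiable paths in the snake are covered by finitely many contracted copies of the snake. -/
theorem exists_finite_weakContraction_cover {a b : ℝ} (hab : a ≤ b) {L : NNReal}
    {g : Set.Icc a b → snake} (hg : LipschitzWith L g) :
    ∃ F : Set (snake → snake), F.Finite ∧ (∀ f ∈ F, IsWeakContraction f) ∧
      Set.range g ⊆ ⋃ f ∈ F, Set.range f := by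
  obtain ⟨k, hk⟩ := exists_nat_gt (L : ℝ)
  have hk0 : (0 : ℝ) < k := L.2.trans_lt hk
  -- The norm maps the snake onto [0,1]; this is rescaled to the i-th subinterval of length 1/k,
  -- then sent along `g`. `projIcc` clamps the last subinterval, which may overshoot b. Since L < k,
  -- the Lipschitz constant L / k is below 1.
  let f : ℕ → snake → snake := fun i p =>
    g (Set.projIcc a b hab (a + (i + ‖(p : EuclideanSpace ℝ (Fin 2))‖) / k))
  refine ⟨f '' Set.Iic ⌊(b - a) * k⌋₊, (Set.finite_Iic _).image f, ?_, ?_⟩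
  · rintro _ ⟨i, -, rfl⟩ p q hpq
    have hd : 0 < dist p q := dist_pos.mpr hpq
    calc dist (f i p) (f i q)
        ≤ L * dist (Set.projIcc a b hab (a + (i + ‖(p : EuclideanSpace ℝ (Fin 2))‖) / k))
          (Set.projIcc a b hab (a + (i + ‖(q : EuclideanSpace ℝ (Fin 2))‖) / k)) :=
          hg.dist_le_mul _ _
      _ ≤ L * (dist p q / k) := by
          refine mul_le_mul_of_nonneg_left ?_ L.2
          refine ((LipschitzWith.projIcc hab).dist_le_mul _ _).trans ?_
          rw [NNReal.coe_one, one_mul, Real.dist_eq,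
            show ∀ x y : ℝ, a + (i + x) / k - (a + (i + y) / k) = (x - y) / k by intros; ring,
            abs_div, abs_of_pos hk0]
          gcongr
          exact (abs_norm_sub_norm_le _ _).trans_eq (dist_eq_norm _ _).symm
      _ = L / k * dist p q := by ring
      _ < 1 * dist p q := by
          gcongr
          rwa [div_lt_one hk0]
      _ = _ := one_mul _
  · rintro _ ⟨x, rfl⟩
    have hx : 0 ≤ (x - a) * k := mul_nonneg (by linarith [x.2.1]) hk0.le
    obtain ⟨p, hp⟩ := exists_snake_norm_eq (x := (x - a) * k - ⌊(x - a) * k⌋₊)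
      ⟨by linarith [Nat.floor_le hx], by linarith [Nat.lt_floor_add_one ((x - a) * k)]⟩
    refine Set.mem_biUnion ⟨⌊(x - a) * k⌋₊, Set.mem_Iic.mpr ?_, rfl⟩ ⟨p, ?_⟩
    · exact Nat.floor_le_floor (by gcongr; exact x.2.2)
    · simp only [f, hp]
      congr 1
      rw [show a + ((⌊(x - a) * k⌋₊ : ℝ) + ((x - a) * k - ⌊(x - a) * k⌋₊)) / k = x by
        field_simp
        ring]
      exact Set.projIcc_val hab x

theorem exists_weakContraction_cover_ring {n : ℕ} (hn : 1 ≤ n) :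
    ∃ F : Set (snake → snake), F.Finite ∧ (∀ f ∈ F, IsWeakContraction f) ∧
      ∀ p : snake, ((p : EuclideanSpace ℝ (Fin 2)) ∈ snakeArc n ∨
        (p : EuclideanSpace ℝ (Fin 2)) ∈ snakeSegment n) → ∃ f ∈ F, p ∈ Set.range f := by
  have hn' : (0 : ℝ) < n := by exact_mod_cast hn
  have hpi := Real.pi_pos
  let g₁ : Set.Icc (Real.pi / 2) (2 * Real.pi) → snake :=
    fun α => ⟨_, polarPoint_mem_snake_of_arc hn α.2⟩
  let g₂ : Set.Icc (1 / ((n : ℝ) + 1)) (1 / n) → snake :=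
    fun r => ⟨_, polarPoint_mem_snake_of_segment hn r.2⟩
  have hg₁ : LipschitzWith (1 / n) g₁ := LipschitzWith.of_dist_le_mul fun α β => by
    simpa [g₁, Subtype.dist_eq] using
      dist_polarPoint_angle_le (r := 1 / n) (by positivity) α β
  have hg₂ : LipschitzWith 1 g₂ := LipschitzWith.of_dist_le_mul fun r s => by
    rw [NNReal.coe_one, one_mul]
    exact (dist_polarPoint_radius _ _ _).le
  obtain ⟨F₁, hF₁, hw₁, hc₁⟩ := exists_finite_weakContraction_cover (by linarith) hg₁
  obtain ⟨F₂, hF₂, hw₂, hc₂⟩ := exists_finite_weakContraction_cover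
    (one_div_le_one_div_of_le hn' (by linarith)) hg₂
  refine ⟨F₁ ∪ F₂, hF₁.union hF₂, fun f hf => hf.elim (hw₁ f) (hw₂ f), ?_⟩
  rintro p (⟨α, hα, hp⟩ | ⟨r, hr, hp⟩)
  · have h : p ∈ Set.range g₁ := ⟨⟨α, hα⟩, Subtype.ext hp.symm⟩
    obtain ⟨f, hf, hpf⟩ := Set.mem_iUnion₂.mp (hc₁ h)
    exact ⟨f, Or.inl hf, hpf⟩
  · have h : p ∈ Set.range g₂ := ⟨⟨r, hr⟩, Subtype.ext hp.symm⟩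
    obtain ⟨f, hf, hpf⟩ := Set.mem_iUnion₂.mp (hc₂ h)
    exact ⟨f, Or.inr hf, hpf⟩

theorem isWeakIFSAttractor_snake : IsWeakIFSAttractor (Set.univ : Set snake) := by
  obtain ⟨F₁, hF₁, hw₁, hc₁⟩ := exists_weakContraction_cover_ring (n := 1) (by norm_num)
  obtain ⟨F₂, hF₂, hw₂, hc₂⟩ := exists_weakContraction_cover_ring (n := 2) (by norm_num)
  let s : snake → snake := fun p => ⟨shrink p, shrink_mem_snake p.2⟩
  refine ⟨insert s (F₁ ∪ F₂), (hF₁.union hF₂).insert s, ?_, ⟨⟨0, zero_mem_snake⟩, trivial⟩,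
    isCompact_univ, Eq.symm (Set.eq_univ_of_forall fun p => ?_)⟩
  · rintro f (rfl | hf)
    · rintro ⟨p, hp⟩ ⟨q, hq⟩ hpq
      obtain ⟨r, α, hr, rfl⟩ := exists_polarPoint_of_mem_snake hp
      obtain ⟨t, β, ht, rfl⟩ := exists_polarPoint_of_mem_snake hq
      exact dist_shrink_lt hr ht fun h => hpq (Subtype.ext h)
    · exact hf.elim (hw₁ f) (hw₂ f)
  · suffices ∃ f ∈ insert s (F₁ ∪ F₂), p ∈ Set.range f by
      obtain ⟨f, hf, hpf⟩ := this
      exact Set.mem_biUnion hf (by rwa [Set.image_univ])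
    rcases mem_snake.mp p.2 with h0 | ⟨n, hn, h⟩
    · exact ⟨s, Or.inl rfl, ⟨0, zero_mem_snake⟩, Subtype.ext (by simp [s, shrink, h0])⟩
    · obtain rfl | rfl | h3 : n = 1 ∨ n = 2 ∨ 3 ≤ n := by omega
      · obtain ⟨f, hf, hpf⟩ := hc₁ p h
        exact ⟨f, Or.inr (Or.inl hf), hpf⟩
      · obtain ⟨f, hf, hpf⟩ := hc₂ p h
        exact ⟨f, Or.inr (Or.inr hf), hpf⟩
      · obtain ⟨q, hq, hqp⟩ := exists_shrink_eq h3 h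
        exact ⟨s, Or.inl rfl, ⟨q, hq⟩, Subtype.ext hqp⟩

/-! ### Lengths of the pieces of the snake -/

open MeasureTheory MeasureTheory.Measure in
theorem hausdorffMeasure_snakeSegment (n : ℕ) :
    μH[1] (snakeSegment n) = ENNReal.ofReal (1 / n - 1 / ((n : ℝ) + 1)) := by
  have h : snakeSegment n = (fun r => polarPoint r (((n % 2 : ℕ) : ℝ) * (Real.pi / 2))) ''
      Set.Icc (1 / ((n : ℝ) + 1)) (1 / n) := by
    ext p
    simp only [snakeSegment, Set.mem_ofPred_eq, Set.mem_image, eq_comm]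
  have hi : Isometry fun r => polarPoint r (((n % 2 : ℕ) : ℝ) * (Real.pi / 2)) :=
    Isometry.of_dist_eq fun r s => dist_polarPoint_radius r s _
  rw [h, hi.hausdorffMeasure_image (Or.inl zero_le_one), hausdorffMeasure_real, Real.volume_Icc]

theorem snakeArc_eq_image (n : ℕ) :
    snakeArc n = polarPoint (1 / n) '' Set.Icc (Real.pi / 2) (2 * Real.pi) := by
  ext p
  simp only [snakeArc, Set.mem_ofPred_eq, Set.mem_image, eq_comm]

theorem isCompact_snakeArc (n : ℕ) : IsCompact (snakeArc n) := by
  rw [snakeArc_eq_image]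
  exact isCompact_Icc.image (continuous_polarPoint.comp (by fun_prop :
    Continuous fun α : ℝ => (1 / (n : ℝ), α)))

open MeasureTheory MeasureTheory.Measure in
theorem hausdorffMeasure_snakeArc_one_ne_top : μH[1] (snakeArc 1) ≠ ⊤ := by
  have h : LipschitzWith 1 (polarPoint (1 / (1 : ℕ))) := LipschitzWith.of_dist_le_mul fun α β => by
    simpa using dist_polarPoint_angle_le (r := 1) zero_le_one α β
  rw [snakeArc_eq_image]
  refine ne_top_of_le_ne_top ?_ (h.hausdorffMeasure_image_le zero_le_one _)
  rw [hausdorffMeasure_real, Real.volume_Icc]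
  simp

-- The projection to the first coordinate does not increase length, and angles from π/2 to π already
-- project onto [-1, 0]. The exact length is never needed, only that it is positive and finite.
open MeasureTheory MeasureTheory.Measure in
theorem hausdorffMeasure_snakeArc_one_ne_zero : μH[1] (snakeArc 1) ≠ 0 := by
  have h : LipschitzWith 1 fun p : EuclideanSpace ℝ (Fin 2) => p 0 :=
    LipschitzWith.of_dist_le_mul fun p q => by
      rw [NNReal.coe_one, one_mul, dist_eq_norm, dist_eq_norm]
      exact PiLp.norm_apply_le (p - q) 0
  have hpi := Real.pi_pos
  have hsub : Set.Icc (-1 : ℝ) 0 ⊆ (fun p : EuclideanSpace ℝ (Fin 2) => p 0) '' snakeArc 1 := by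
    intro x hx
    refine ⟨polarPoint 1 (Real.arccos x), ⟨Real.arccos x, ⟨?_, ?_⟩, by simp⟩, ?_⟩
    · exact Real.arccos_zero.symm.trans_le (Real.arccos_le_arccos hx.2)
    · linarith [Real.arccos_le_pi x]
    · simp [polarPoint, Real.cos_arccos hx.1 (hx.2.trans zero_le_one)]
  have h1 := (measure_mono hsub).trans (h.hausdorffMeasure_image_le zero_le_one (snakeArc 1))
  rw [hausdorffMeasure_real, Real.volume_Icc] at h1
  intro h0
  rw [h0] at h1
  norm_num at h1

/-- The length of the outer arc of the snake. -/
noncomputable def arcLength : ℝ := (MeasureTheory.Measure.hausdorffMeasure 1 (snakeArc 1)).toReal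

theorem arcLength_pos : 0 < arcLength :=
  ENNReal.toReal_pos hausdorffMeasure_snakeArc_one_ne_zero hausdorffMeasure_snakeArc_one_ne_top

open MeasureTheory MeasureTheory.Measure Pointwise in
theorem hausdorffMeasure_snakeArc {n : ℕ} (hn : n ≠ 0) :
    μH[1] (snakeArc n) = ENNReal.ofReal (arcLength * (1 / n)) := by
  have h : snakeArc n = (1 / n : ℝ) • snakeArc 1 := by
    rw [snakeArc_eq_image, snakeArc_eq_image, ← Set.image_smul, Set.image_image]
    simp [smul_polarPoint]
  have hn' : (1 / n : ℝ) ≠ 0 := one_div_ne_zero (Nat.cast_ne_zero.mpr hn)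
  rw [h, hausdorffMeasure_smul₀ zero_le_one hn', NNReal.rpow_one, ENNReal.smul_def, smul_eq_mul,
    mul_comm, ENNReal.ofReal_mul arcLength_pos.le, arcLength,
    ENNReal.ofReal_toReal hausdorffMeasure_snakeArc_one_ne_top, ← enorm_eq_nnnorm,
    Real.enorm_eq_ofReal (by positivity)]

/-- The points of the snake at distance at least `1 / m` from the origin. -/
def outerSnake (m : ℕ) : Set snake := {q | 1 / (m : ℝ) ≤ ‖(q : EuclideanSpace ℝ (Fin 2))‖}

theorem outerSnake_subset (m : ℕ) (hm : 1 ≤ m) : Subtype.val '' outerSnake m ⊆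
    ⋃ n ∈ Finset.range m, (snakeArc (n + 1) ∪ snakeSegment (n + 1)) := by
  rintro _ ⟨⟨q, hq⟩, hqm, rfl⟩
  have hm' : (0 : ℝ) < m := by exact_mod_cast hm
  have hqm : 1 / (m : ℝ) ≤ ‖q‖ := hqm
  rcases mem_snake.mp hq with rfl | ⟨n, hn, h⟩
  · rw [norm_zero] at hqm
    exact absurd hqm (not_le.mpr (by positivity))
  · obtain ⟨k, rfl⟩ := Nat.exists_eq_add_of_le' hn
    refine Set.mem_biUnion (x := k) (Finset.mem_coe.mpr (Finset.mem_range.mpr ?_)) h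
    have hle : ‖q‖ ≤ 1 / ((k + 1 : ℕ) : ℝ) :=
      h.elim (fun h => (norm_of_mem_snakeArc h).le) fun h => (norm_of_mem_snakeSegment h).2
    have h2 := le_of_one_div_le_one_div hm' (hqm.trans hle)
    exact_mod_cast h2

/-- Partial sums of the harmonic series. -/
noncomputable def harmonicSum (m : ℕ) : ℝ := ∑ n ∈ Finset.range m, 1 / ((n : ℝ) + 1)

-- The arcs contribute the harmonic sum; the segments telescope to at most 1.
open MeasureTheory MeasureTheory.Measure in
theorem hausdorffMeasure_outerSnake_le {m : ℕ} (hm : 1 ≤ m) :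
    μH[1] (outerSnake m) ≤ ENNReal.ofReal (arcLength * harmonicSum m + 1) := by
  have ha := arcLength_pos
  have h0 : ∀ n : ℕ, (0 : ℝ) ≤ 1 / ((n + 1 : ℕ) : ℝ) - 1 / (((n + 1 : ℕ) : ℝ) + 1) := fun n =>
    sub_nonneg.mpr (one_div_le_one_div_of_le (by positivity) (by linarith))
  rw [← isometry_subtype_coe.hausdorffMeasure_image (Or.inl zero_le_one)]
  calc _ ≤ μH[1] (⋃ n ∈ Finset.range m, (snakeArc (n + 1) ∪ snakeSegment (n + 1))) :=
        measure_mono (outerSnake_subset m hm)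
    _ ≤ ∑ n ∈ Finset.range m, μH[1] (snakeArc (n + 1) ∪ snakeSegment (n + 1)) :=
        measure_biUnion_finset_le _ _
    _ ≤ ∑ n ∈ Finset.range m, ENNReal.ofReal (arcLength * (1 / ((n + 1 : ℕ) : ℝ)) +
          (1 / ((n + 1 : ℕ) : ℝ) - 1 / (((n + 1 : ℕ) : ℝ) + 1))) := by
        refine Finset.sum_le_sum fun n _ => (measure_union_le _ _).trans_eq ?_
        rw [ENNReal.ofReal_add (by positivity) (h0 n), hausdorffMeasure_snakeArc (by omega),
          hausdorffMeasure_snakeSegment]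
    _ = ENNReal.ofReal (∑ n ∈ Finset.range m, (arcLength * (1 / ((n + 1 : ℕ) : ℝ)) +
          (1 / ((n + 1 : ℕ) : ℝ) - 1 / (((n + 1 : ℕ) : ℝ) + 1)))) :=
        (ENNReal.ofReal_sum_of_nonneg fun n _ => add_nonneg (by positivity) (h0 n)).symm
    _ ≤ _ := by
        refine ENNReal.ofReal_le_ofReal ?_
        have h1 := Finset.sum_range_sub' (fun n : ℕ => 1 / ((n : ℝ) + 1)) m
        push_cast at h1 ⊢
        rw [Finset.sum_add_distrib, ← Finset.mul_sum, h1, harmonicSum]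
        have : (0 : ℝ) ≤ 1 / ((m : ℝ) + 1) := by positivity
        norm_num at this ⊢
        linarith

open MeasureTheory MeasureTheory.Measure in
theorem hausdorffMeasure_iUnion_snakeArc {N m : ℕ} (h : N ≤ m) :
    μH[1] (⋃ n ∈ Finset.Ico N m, snakeArc (n + 1)) =
      ENNReal.ofReal (arcLength * (harmonicSum m - harmonicSum N)) := by
  have ha := arcLength_pos
  rw [measure_biUnion_finset, harmonicSum, harmonicSum, ← Finset.sum_Ico_eq_sub _ h,
    Finset.mul_sum, ENNReal.ofReal_sum_of_nonneg fun n _ => by positivity]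
  · refine Finset.sum_congr rfl fun n _ => ?_
    rw [hausdorffMeasure_snakeArc (by omega)]
    push_cast
    rfl
  · intro i _ j _ hij
    refine Set.disjoint_left.mpr fun p hi hj => hij ?_
    have h1 := (norm_of_mem_snakeArc hi).symm.trans (norm_of_mem_snakeArc hj)
    push_cast at h1
    rw [one_div, one_div, inv_inj] at h1
    exact_mod_cast add_right_cancel h1
  · exact fun n _ => (isCompact_snakeArc _).measurableSet

theorem tendsto_harmonicSum : Filter.Tendsto harmonicSum Filter.atTop Filter.atTop :=
  Real.tendsto_sum_range_one_div_nat_succ_atTop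

/-! ### The snake is not an IFS attractor -/

/-- A preimage of a point close to the origin under a contraction is at least as far
from the origin. -/
theorem exists_norm_le_norm_of_contraction {K : NNReal} {g : snake → snake}
    (hg : ContractingWith K g) : ∃ ε > 0, ∀ q : snake,
      ‖(g q : EuclideanSpace ℝ (Fin 2))‖ < ε →
        ‖(g q : EuclideanSpace ℝ (Fin 2))‖ ≤ ‖(q : EuclideanSpace ℝ (Fin 2))‖ := by
  set o : snake := ⟨0, zero_mem_snake⟩
  have hd : ∀ q : snake, dist (g q) (g o) ≤ ‖(q : EuclideanSpace ℝ (Fin 2))‖ := by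
    intro q
    refine (hg.2.dist_le_mul q o).trans ?_
    rw [Subtype.dist_eq, dist_zero_right]
    exact mul_le_of_le_one_left (norm_nonneg _) (by exact_mod_cast hg.1.le)
  by_cases h0 : g o = o
  · refine ⟨1, one_pos, fun q _ => ?_⟩
    have := hd q
    rwa [h0, Subtype.dist_eq, dist_zero_right] at this
  · have hpos : 0 < ‖(g o : EuclideanSpace ℝ (Fin 2))‖ :=
      norm_pos_iff.mpr fun h => h0 (Subtype.ext h)
    -- If g moves the origin and |g q| < |g 0|/2, then |q| ≥ |g q - g 0| ≥ |g 0| - |g q| > |g q|.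
    refine ⟨_, half_pos hpos, fun q hq => ?_⟩
    have h1 := hd q
    rw [Subtype.dist_eq, dist_comm, dist_eq_norm] at h1
    have h2 := norm_sub_norm_le (g o : EuclideanSpace ℝ (Fin 2)) (g q)
    linarith

open MeasureTheory MeasureTheory.Measure in
/-- The image of a contraction of the snake is not a neighbourhood of the origin. -/
theorem range_notMem_nhds_of_contraction {K : NNReal} {g : snake → snake}
    (hg : ContractingWith K g) : Set.range g ∉ nhds ⟨0, zero_mem_snake⟩ := by
  intro hnhds
  obtain ⟨ε, hε, hball⟩ := Metric.mem_nhds_iff.mp hnhds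
  obtain ⟨δ, hδ, hnorm⟩ := exists_norm_le_norm_of_contraction hg
  obtain ⟨N, hN⟩ := exists_nat_one_div_lt (lt_min hε hδ)
  have ha := arcLength_pos
  have hK : (0 : ℝ) < 1 - K := sub_pos.mpr (by exact_mod_cast hg.1)
  -- Arcs of radius 1/(N+1), ..., 1/m lie in the image of `outerSnake m`; compare lengths.
  have hbound : ∀ m, N + 1 ≤ m → arcLength * (harmonicSum m - harmonicSum N) ≤
      K * (arcLength * harmonicSum m + 1) := by
    intro m hm
    have hm' : (0 : ℝ) < m := by exact_mod_cast (by omega : 0 < m)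
    have hH : 0 ≤ harmonicSum m := Finset.sum_nonneg fun n _ => by positivity
    have hsub : (⋃ n ∈ Finset.Ico N m, snakeArc (n + 1)) ⊆
        (fun q => (g q : EuclideanSpace ℝ (Fin 2))) '' outerSnake m := by
      intro p hp
      obtain ⟨n, hn, hpn⟩ := Set.mem_iUnion₂.mp hp
      obtain ⟨hn1, hn2⟩ := Finset.mem_Ico.mp hn
      have hps : p ∈ snake := mem_snake.mpr (Or.inr ⟨n + 1, by omega, Or.inl hpn⟩)
      have hpnorm : ‖p‖ < min ε δ := by
        rw [norm_of_mem_snakeArc hpn]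
        refine lt_of_le_of_lt (one_div_le_one_div_of_le (by positivity) ?_) hN
        exact_mod_cast Nat.add_le_add_right hn1 1
      obtain ⟨q, hq⟩ : (⟨p, hps⟩ : snake) ∈ Set.range g := by
        refine hball (Metric.mem_ball.mpr ?_)
        rw [Subtype.dist_eq, dist_zero_right]
        exact hpnorm.trans_le (min_le_left _ _)
      have hq' : (g q : EuclideanSpace ℝ (Fin 2)) = p := congrArg Subtype.val hq
      refine ⟨q, ?_, hq'⟩
      have h1 := hnorm q (by rw [hq']; exact hpnorm.trans_le (min_le_right _ _))
      rw [hq', norm_of_mem_snakeArc hpn] at h1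
      refine le_trans (one_div_le_one_div_of_le (by positivity) ?_) h1
      exact_mod_cast hn2
    have hlip : LipschitzWith K fun q => (g q : EuclideanSpace ℝ (Fin 2)) := by
      rw [← one_mul K]
      exact (LipschitzWith.subtype_val snake).comp hg.2
    have h1 := (measure_mono hsub).trans (hlip.hausdorffMeasure_image_le zero_le_one _)
    rw [hausdorffMeasure_iUnion_snakeArc (by omega), ENNReal.rpow_one] at h1
    have h2 := h1.trans (mul_le_mul_right (hausdorffMeasure_outerSnake_le (by omega : 1 ≤ m)) _)
    rw [← ENNReal.ofReal_coe_nnreal, ← ENNReal.ofReal_mul K.coe_nonneg] at h2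
    exact (ENNReal.ofReal_le_ofReal_iff (by positivity)).mp h2
  -- The threshold is `hbound` solved for `harmonicSum m`; division by 1 - K is where K < 1 enters.
  obtain ⟨m, hm, hlarge⟩ := ((Filter.eventually_ge_atTop (N + 1)).and
    (tendsto_harmonicSum.eventually_gt_atTop
      ((arcLength * harmonicSum N + K) / (arcLength * (1 - K))))).exists
  rw [div_lt_iff₀ (by positivity)] at hlarge
  have := hbound m hm
  linarith

/-- A closed connected subset of an arc either is a neighbourhood of an end, or misses all other
points near that end. -/
theorem mem_nhds_or_eventually_notMem {C : Set (Set.Icc (0 : ℝ) 1)} (hC : IsClosed C)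
    (hconn : IsPreconnected C) :
    C ∈ nhds 0 ∨ ∀ᶠ t in nhdsWithin 0 (Set.Ioi 0), t ∉ C := by
  by_cases h0 : (0 : Set.Icc (0 : ℝ) 1) ∈ C
  · by_cases h1 : ∃ t ∈ C, 0 < t
    · obtain ⟨t, ht, hpos⟩ := h1
      left
      filter_upwards [Iic_mem_nhds hpos] with s hs
      exact hconn.Icc_subset h0 ht ⟨s.2.1, hs⟩
    · right
      filter_upwards [self_mem_nhdsWithin] with t ht htC using h1 ⟨t, htC, ht⟩
  · exact Or.inr (mem_nhdsWithin_of_mem_nhds (hC.isOpen_compl.mem_nhds h0))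

theorem not_covered_by_contractions {G : Set (snake → snake)} (hG : G.Finite)
    (hc : ∀ g ∈ G, IsContraction g) : ∃ p : snake, ∀ g ∈ G, p ∉ Set.range g := by
  have : PreconnectedSpace (Set.Icc (0 : ℝ) 1) := Subtype.preconnectedSpace isPreconnected_Icc
  have h : ∀ g ∈ G, ∀ᶠ t in nhdsWithin 0 (Set.Ioi 0), snakeHomeo t ∉ Set.range g := by
    intro g hg
    obtain ⟨K, hK⟩ := hc g hg
    have hr : snakeHomeo ⁻¹' Set.range g = Set.range (snakeHomeo.symm ∘ g ∘ snakeHomeo) := by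
      rw [Set.range_comp, Set.range_comp, snakeHomeo.range_coe, Set.image_univ,
        snakeHomeo.image_symm]
    have hcont : Continuous (snakeHomeo.symm ∘ g ∘ snakeHomeo) :=
      snakeHomeo.symm.continuous.comp (hK.2.continuous.comp snakeHomeo.continuous)
    refine (mem_nhds_or_eventually_notMem (C := snakeHomeo ⁻¹' Set.range g) ?_ ?_).resolve_left ?_
    · rw [hr]
      exact (isCompact_range hcont).isClosed
    · rw [hr]
      exact isPreconnected_range hcont
    · intro hn
      refine range_notMem_nhds_of_contraction hK ?_
      have := snakeHomeo.isOpenMap.image_mem_nhds hn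
      rwa [snakeHomeo.image_preimage, snakeHomeo_zero] at this
  have hne : (nhdsWithin (0 : Set.Icc (0 : ℝ) 1) (Set.Ioi 0)).NeBot :=
    nhdsGT_neBot_of_exists_gt ⟨1, zero_lt_one⟩
  obtain ⟨t, ht⟩ := ((Filter.eventually_all_finite hG).mpr h).exists
  exact ⟨snakeHomeo t, ht⟩

/-- The attractor equation forces each map to send the copy of the snake into itself, so the IFS
pulls back along e to contractions of the snake whose ranges cover it. -/
theorem not_isIFSAttractor_range {X : Type u} [MetricSpace X] {e : snake → X} (he : Isometry e) :
    ¬ IsIFSAttractor (Set.range e) := by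
  rintro ⟨F, hF, hc, -, -, hcover⟩
  have hex : ∀ f ∈ F, ∃ g : snake → snake, IsContraction g ∧ ∀ q, e (g q) = f (e q) := by
    intro f hf
    have hm : ∀ q, f (e q) ∈ Set.range e := fun q => by
      rw [hcover]
      exact Set.mem_biUnion hf ⟨e q, ⟨q, rfl⟩, rfl⟩
    choose g hg using hm
    obtain ⟨K, hK⟩ := hc f hf
    refine ⟨g, ⟨K, hK.1, fun p q => ?_⟩, hg⟩
    rw [← he.edist_eq, hg, hg, ← he.edist_eq p q]
    exact hK.2 _ _
  have : Nonempty (snake → snake) := ⟨id⟩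
  choose! φ hφ using hex
  obtain ⟨p, hp⟩ := not_covered_by_contractions (hF.image φ) (by
    rintro _ ⟨f, hf, rfl⟩
    exact (hφ f hf).1)
  have hpe : e p ∈ ⋃ f ∈ F, f '' Set.range e := hcover ▸ Set.mem_range_self p
  obtain ⟨f, hf, _, ⟨q, rfl⟩, hq⟩ := Set.mem_iUnion₂.mp hpe
  refine hp _ ⟨f, hf, rfl⟩ ⟨q, he.injective ?_⟩
  rw [(hφ f hf).2, hq]

theorem mainTheorem1 :
    IsArc snake ∧
    IsWeakIFSAttractor (Set.univ : Set snake) ∧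
    IsBanachFractal snake ∧
    (∀ (X : Type u) [MetricSpace X] (e : snake → X), Isometry e →
      ¬ IsIFSAttractor (Set.range e)) :=
  ⟨isArc_snake, isWeakIFSAttractor_snake, isBanachFractal_snake,
    fun _ _ _ he => not_isIFSAttractor_range he⟩
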